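/- **Theorem A.** Let $F$ be a non-abelian free group with free generating set $S_0$, put $\mathcal S=S_0\cup S_0^{-1}$, and let $k>0$ be an integer. If $\phi:F\to\mathbb R$ is a $\Delta$-decomposable quasimorphism (with respect to $\mathcal S$) and $\alpha\in H_b^k(F,\mathbb R)$ is arbitrary, then $$[\delta^1\phi]\cup\alpha=0\quad\text{in } H_b^{k+2}(F,\mathbb R).$$ Here the terms have the following meaning. *Bounded cohomology.* For a group $G$, $C^n(G,\mathbb R)$ is the space of all functions $G^n\to\mathbb R$ and $C_b^n(G,\mathbb R)$ the subspace of bounded ones; $$\delta^n f(g_1,\dots,g_{n+1})=f(g_2,\dots,g_{n+1})+\sum_{j=1}^n(-1)^jf(g_1,\dots,g_jg_{j+1},\dots,g_{n+1})+(-1)^{n+1}f(g_1,\dots,g_n),$$ and $H_b^n(G,\mathbb R)=\ker(\delta^n|_{C_b^n})/\delta^{n-1}(C_b^{n-1})$ (with $C_b^{-1}=0$). The cup product on $H_b^*(G,\mathbb R)$ is induced by $(f\cup g)(g_1,\dots,g_{n+m})=f(g_1,\dots,g_n)\,g(g_{n+1},\dots,g_{n+m})$. A quasimorphism is a map $\phi:G\to\mathbb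 R$ with $\sup_{g,h}|\phi(g)+\phi(h)-\phi(gh)|<\infty$; it defines the class $[\delta^1\phi]\in H_b^2(G,\mathbb R)$. *$\Delta$-decompositions.* Let $\mathcal P\subset F$ satisfy $\mathcal P=\mathcal P^{-1}$ and $1\notin\mathcal P$, and let $\mathcal P^*$ be the set of finite (possibly empty) sequences of elements of $\mathcal P$. A $\Delta$-decomposition of $F$ into the pieces $\mathcal P$ is a map $\Delta:F\to\mathcal P^*$ such that: * [A] for every $g\in F$ with $\Delta(g)=(g_1,\dots,g_K)$, one has $g=g_1\cdots g_K$ as a reduced word with respect to $\mathcal S$ (the reduced word of $g$ is the concatenation of those of the $g_j$), $\Delta(g^{-1})=(g_K^{-1},\dots,g_1^{-1})$, and $\Delta(g_i\cdots g_j)=(g_i,\dots,g_j)$ for all $1\le i\le j\le K$; * [B] there is a constant $R>0$ such that for all $g,h\in F$ there are $c_1,c_2,c_3,r_1,r_2,r_3\in F$ with (juxtaposition denoting concatenation) $$\Delta(g)=\Delta(c_1^{-1})\Delta(r_1)\Delta(c_2),\quad \Delta(h)=\Delta(c_2^{-1})\Delta(r_2)\Delta(c_3),\quad \Delta(gh)=\Delta(c_1^{-1})\Delta(r_3^{-1})\Delta(c_3),$$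 where the lengths of the sequences $\Delta(c_1),\Delta(c_2),\Delta(c_3)$ are maximal among all such expressions, and the sequences $\Delta(r_1),\Delta(r_2),\Delta(r_3)$ have length at most $R$. *$\Delta$-decomposable quasimorphisms.* A map $\phi:F\to\mathbb R$ is a $\Delta$-decomposable quasimorphism if there are a set of pieces $\mathcal P$, a $\Delta$-decomposition $\Delta$ of $F$ into the pieces $\mathcal P$, and a bounded function $\lambda:\mathcal P\to\mathbb R$ with $\lambda(p^{-1})=-\lambda(p)$ for all $p\in\mathcal P$, such that $\phi(g)=\sum_{j=1}^K\lambda(g_j)$ for every $g\in F$ with $\Delta(g)=(g_1,\dots,g_K)$. (Every such map is a quasimorphism.) -/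

import Mathlib

namespace BoundedCohomology

section Cochains

variable (G : Type*) [Group G]

/-- Inhomogeneous real `n`-cochains of the group `G`. -/
abbrev Cochain (n : ℕ) : Type _ := (Fin n → G) → ℝ

/-- The inhomogeneous coboundary map with trivial real coefficients:
`(δⁿ f)(g₁, …, gₙ₊₁) = f(g₂, …, gₙ₊₁) + ∑_{1 ≤ j ≤ n} (-1)^j f(g₁, …, g_j g_{j+1}, …, gₙ₊₁)`
`+ (-1)^(n+1) f(g₁, …, gₙ)` (positions are counted from `0` in the code). -/
def coboundary (n : ℕ) : Cochain G n →ₗ[ℝ] Cochain G (n + 1) where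
  toFun f x := f (fun i => x i.succ)
    + ∑ j : Fin n, (-1 : ℝ) ^ ((j : ℕ) + 1) * f (Fin.contractNth j.castSucc (· * ·) x)
    + (-1 : ℝ) ^ (n + 1) * f (fun i => x i.castSucc)
  map_add' f g := by
    funext x
    simp only [Pi.add_apply, mul_add, Finset.sum_add_distrib]
    ring
  map_smul' c f := by
    funext x
    simp only [Pi.smul_apply, smul_eq_mul, RingHom.id_apply, mul_add, Finset.mul_sum]
    congr 1
    · congr 1
      refine Finset.sum_congr rfl fun j _ => ?_
      ring
    · ring

/-- The bounded `n`-cochains. -/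
def boundedCochains (n : ℕ) : Submodule ℝ (Cochain G n) where
  carrier := {f | ∃ C : ℝ, ∀ x, |f x| ≤ C}
  add_mem' := by
    rintro f g ⟨C, hC⟩ ⟨D, hD⟩
    exact ⟨C + D, fun x => (abs_add_le _ _).trans (add_le_add (hC x) (hD x))⟩
  zero_mem' := ⟨0, fun x => by simp⟩
  smul_mem' := by
    rintro c f ⟨C, hC⟩
    refine ⟨|c| * C, fun x => ?_⟩
    rw [Pi.smul_apply, smul_eq_mul, abs_mul]
    exact mul_le_mul_of_nonneg_left (hC x) (abs_nonneg c)

/-- The bounded `n`-cocycles. -/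
def boundedCocycles (n : ℕ) : Submodule ℝ (Cochain G n) :=
  boundedCochains G n ⊓ LinearMap.ker (coboundary G n)

/-- The bounded `n`-coboundaries: the images under `δ` of the *bounded* `(n-1)`-cochains. -/
def boundedCoboundaries : (n : ℕ) → Submodule ℝ (Cochain G n)
  | 0 => ⊥
  | n + 1 => (boundedCochains G n).map (coboundary G n)

/-- The bounded cohomology `H_b^n(G, ℝ)`: bounded cocycles modulo bounded coboundaries. -/
abbrev Hb (n : ℕ) : Type _ :=
  boundedCocycles G n ⧸ (boundedCoboundaries G n).submoduleOf (boundedCocycles G n)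

end Cochains

section Cup

variable {G : Type*} [Group G]

/-- The cup product of cochains:
`(f ∪ g)(x₁, …, xₙ₊ₘ) = f(x₁, …, xₙ) * g(xₙ₊₁, …, xₙ₊ₘ)`. -/
def cupCochain {n m : ℕ} (f : Cochain G n) (g : Cochain G m) : Cochain G (n + m) :=
  fun x => f (fun i => x (Fin.castAdd m i)) * g (fun i => x (Fin.natAdd n i))

theorem cupCochain_mem_bounded {n m : ℕ} {f : Cochain G n} {g : Cochain G m}
    (hf : f ∈ boundedCochains G n) (hg : g ∈ boundedCochains G m) :
    cupCochain f g ∈ boundedCochains G (n + m) := by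
  obtain ⟨C, hC⟩ := hf
  obtain ⟨D, hD⟩ := hg
  refine ⟨C * D, fun x => ?_⟩
  rw [cupCochain, abs_mul]
  exact mul_le_mul (hC _) (hD _) (abs_nonneg _) ((abs_nonneg _).trans (hC fun _ => 1))

/-- The Leibniz rule `δ(f ∪ g) = δf ∪ g + (-1)ⁿ f ∪ δg`, evaluated at a tuple. -/
theorem coboundary_cupCochain {n m : ℕ} (f : Cochain G n) (g : Cochain G m)
    (x : Fin (n + m + 1) → G) :
    coboundary G (n + m) (cupCochain f g) x =
      coboundary G n f (fun i => x ⟨i, by omega⟩) * g (fun i => x ⟨n + 1 + i, by omega⟩)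
      + (-1 : ℝ) ^ n * (f (fun i => x ⟨i, by omega⟩)
        * coboundary G m g (fun i => x ⟨n + i, by omega⟩)) := by
  have h1 : ∀ j : Fin n, cupCochain f g
      (Fin.contractNth (Fin.castAdd m j).castSucc (· * ·) x)
      = f (Fin.contractNth j.castSucc (· * ·) (fun i => x ⟨i, by omega⟩))
        * g (fun i => x ⟨n + 1 + i, by omega⟩) := by
    intro j
    unfold cupCochain
    congr 2
    funext i
    have hj := j.2
    simp only [Fin.contractNth, Fin.val_castSucc, Fin.val_castAdd, Fin.val_natAdd]
    rw [if_neg (by omega), if_neg (by omega)]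
    congr 1
    ext
    simp
    omega
  have h2 : ∀ j : Fin m, cupCochain f g
      (Fin.contractNth (Fin.natAdd n j).castSucc (· * ·) x)
      = f (fun i => x ⟨i, by omega⟩)
        * g (Fin.contractNth j.castSucc (· * ·) (fun i => x ⟨n + i, by omega⟩)) := by
    intro j
    unfold cupCochain
    congr 2
    · funext i
      have hi := i.2
      simp only [Fin.contractNth, Fin.val_castSucc, Fin.val_castAdd, Fin.val_natAdd]
      rw [if_pos (by omega)]
      rfl
    · funext i
      simp only [Fin.contractNth, Fin.val_castSucc, Fin.val_natAdd, add_lt_add_iff_left,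
        add_right_inj]
      rfl
  have h3 : cupCochain f g (fun i => x i.succ)
      = f (fun i => x ⟨i + 1, by omega⟩) * g (fun i => x ⟨n + 1 + i, by omega⟩) := by
    have e : (fun i : Fin m => x (Fin.natAdd n i).succ)
        = fun i : Fin m => x ⟨n + 1 + i, by omega⟩ :=
      funext fun i => congrArg x (Fin.ext (Nat.add_right_comm n i 1))
    have e' : cupCochain f g (fun i => x i.succ) = f (fun i => x ⟨i + 1, by omega⟩)
        * g (fun i : Fin m => x (Fin.natAdd n i).succ) := rfl
    rw [e', e]
  have h4 : cupCochain f g (fun i => x i.castSucc)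
      = f (fun i => x ⟨i, by omega⟩) * g (fun i => x ⟨n + i, by omega⟩) := rfl
  have h5 : (fun i : Fin m => x ⟨n + (i + 1), by omega⟩)
      = fun i : Fin m => x ⟨n + 1 + i, by omega⟩ :=
    funext fun i => congrArg x (Fin.ext (by change n + (i + 1) = n + 1 + i; omega))
  have hL : coboundary G (n + m) (cupCochain f g) x =
      cupCochain f g (fun i => x i.succ)
      + ∑ j : Fin (n + m), (-1 : ℝ) ^ ((j : ℕ) + 1)
          * cupCochain f g (Fin.contractNth j.castSucc (· * ·) x)
      + (-1 : ℝ) ^ (n + m + 1) * cupCochain f g (fun i => x i.castSucc) := rfl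
  have hf : coboundary G n f (fun i => x ⟨i, by omega⟩) =
      f (fun i => x ⟨i + 1, by omega⟩)
      + ∑ j : Fin n, (-1 : ℝ) ^ ((j : ℕ) + 1)
          * f (Fin.contractNth j.castSucc (· * ·) (fun i => x ⟨i, by omega⟩))
      + (-1 : ℝ) ^ (n + 1) * f (fun i => x ⟨i, by omega⟩) := rfl
  have hg : coboundary G m g (fun i => x ⟨n + i, by omega⟩) =
      g (fun i => x ⟨n + (i + 1), by omega⟩)
      + ∑ j : Fin m, (-1 : ℝ) ^ ((j : ℕ) + 1)
          * g (Fin.contractNth j.castSucc (· * ·) (fun i => x ⟨n + i, by omega⟩))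
      + (-1 : ℝ) ^ (m + 1) * g (fun i => x ⟨n + i, by omega⟩) := rfl
  rw [hL, Fin.sum_univ_add, hf, hg, h5, h3, h4]
  simp only [h1, h2, Fin.val_castAdd, Fin.val_natAdd]
  have e1 : ∑ j : Fin m, (-1 : ℝ) ^ (n + (j : ℕ) + 1) * (f (fun i => x ⟨i, by omega⟩)
        * g (Fin.contractNth j.castSucc (· * ·) (fun i => x ⟨n + i, by omega⟩)))
      = (-1 : ℝ) ^ n * (f (fun i => x ⟨i, by omega⟩) * ∑ j : Fin m, (-1 : ℝ) ^ ((j : ℕ) + 1)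
        * g (Fin.contractNth j.castSucc (· * ·) (fun i => x ⟨n + i, by omega⟩))) := by
    rw [Finset.mul_sum, Finset.mul_sum]
    refine Finset.sum_congr rfl fun j _ => ?_
    ring
  have e2 : ∑ j : Fin n, (-1 : ℝ) ^ ((j : ℕ) + 1)
        * (f (Fin.contractNth j.castSucc (· * ·) (fun i => x ⟨i, by omega⟩))
          * g (fun i => x ⟨n + 1 + i, by omega⟩))
      = (∑ j : Fin n, (-1 : ℝ) ^ ((j : ℕ) + 1)
        * f (Fin.contractNth j.castSucc (· * ·) (fun i => x ⟨i, by omega⟩)))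
          * g (fun i => x ⟨n + 1 + i, by omega⟩) := by
    rw [Finset.sum_mul]
    refine Finset.sum_congr rfl fun j _ => ?_
    ring
  rw [e1, e2]
  ring

theorem cupCochain_mem_cocycles {n m : ℕ} {f : Cochain G n} {g : Cochain G m}
    (hf : f ∈ boundedCocycles G n) (hg : g ∈ boundedCocycles G m) :
    cupCochain f g ∈ boundedCocycles G (n + m) := by
  refine ⟨cupCochain_mem_bounded hf.1 hg.1, ?_⟩
  have hf0 : coboundary G n f = 0 := hf.2
  have hg0 : coboundary G m g = 0 := hg.2
  refine LinearMap.mem_ker.2 (funext fun x => ?_)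
  rw [coboundary_cupCochain, hf0, hg0]
  simp

/-- `δψ ∪ g` is a bounded coboundary if `ψ` is bounded and `g` is a bounded cocycle. -/
theorem cupCochain_coboundary_left {n m : ℕ} {f : Cochain G n} {g : Cochain G m}
    (hf : f ∈ boundedCoboundaries G n) (hg : g ∈ boundedCocycles G m) :
    cupCochain f g ∈ boundedCoboundaries G (n + m) := by
  have hg0 : coboundary G m g = 0 := hg.2
  cases n with
  | zero =>
    have hf0 : f = 0 := hf
    subst hf0
    have : cupCochain (0 : Cochain G 0) g = 0 := by
      funext x
      simp [cupCochain]
    rw [this]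
    exact Submodule.zero_mem _
  | succ n =>
    obtain ⟨ψ, hψ, rfl⟩ := hf
    have key : ∀ (N : ℕ) (h : n + m + 1 = N) (F : Cochain G N),
        (∀ x : Fin N → G, F x = coboundary G (n + m) (cupCochain ψ g) (fun i => x (i.cast h))) →
        F ∈ boundedCoboundaries G N := by
      rintro N rfl F hF
      exact ⟨cupCochain ψ g, cupCochain_mem_bounded hψ hg.1, (funext hF).symm⟩
    refine key (n + 1 + m) (by omega) _ fun x => ?_
    rw [coboundary_cupCochain, hg0]
    simp only [Pi.zero_apply, mul_zero, add_zero]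
    rfl

/-- `f ∪ δψ` is a bounded coboundary if `f` is a bounded cocycle and `ψ` is bounded. -/
theorem cupCochain_coboundary_right {n m : ℕ} {f : Cochain G n} {g : Cochain G m}
    (hf : f ∈ boundedCocycles G n) (hg : g ∈ boundedCoboundaries G m) :
    cupCochain f g ∈ boundedCoboundaries G (n + m) := by
  have hf0 : coboundary G n f = 0 := hf.2
  cases m with
  | zero =>
    have hg0 : g = 0 := hg
    subst hg0
    have : cupCochain f (0 : Cochain G 0) = 0 := by
      funext x
      simp [cupCochain]
    rw [this]
    exact Submodule.zero_mem _
  | succ m =>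
    obtain ⟨ψ, hψ, rfl⟩ := hg
    refine ⟨(-1 : ℝ) ^ n • cupCochain f ψ,
      Submodule.smul_mem _ _ (cupCochain_mem_bounded hf.1 hψ), ?_⟩
    rw [map_smul]
    funext x
    refine (congrArg ((-1 : ℝ) ^ n * ·) (coboundary_cupCochain f ψ x)).trans ?_
    rw [hf0]
    simp only [Pi.zero_apply, zero_mul, zero_add]
    rw [← mul_assoc, ← mul_pow]
    simp only [mul_neg, mul_one, neg_neg, one_pow, one_mul]
    rfl

/-- The cup product `H_b^n(G, ℝ) × H_b^m(G, ℝ) → H_b^{n+m}(G, ℝ)`, induced by the cup product of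
cocycles. -/
def cup {n m : ℕ} (a : Hb G n) (b : Hb G m) : Hb G (n + m) :=
  Quotient.liftOn₂ a b
    (fun f g => Submodule.Quotient.mk ⟨cupCochain f.1 g.1, cupCochain_mem_cocycles f.2 g.2⟩)
    (by
      intro f g f' g' hf hg
      have hf1 : f.1 - f'.1 ∈ boundedCoboundaries G n :=
        (Submodule.quotientRel_def ((boundedCoboundaries G n).submoduleOf _)).1 hf
      have hg1 : g.1 - g'.1 ∈ boundedCoboundaries G m :=
        (Submodule.quotientRel_def ((boundedCoboundaries G m).submoduleOf _)).1 hg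
      refine (Submodule.Quotient.eq _).2 ?_
      change cupCochain f.1 g.1 - cupCochain f'.1 g'.1 ∈ boundedCoboundaries G (n + m)
      have e : cupCochain f.1 g.1 - cupCochain f'.1 g'.1
          = cupCochain (f.1 - f'.1) g.1 + cupCochain f'.1 (g.1 - g'.1) := by
        funext x
        simp only [cupCochain, Pi.sub_apply, Pi.add_apply]
        ring
      rw [e]
      exact Submodule.add_mem _ (cupCochain_coboundary_left hf1 g.2)
        (cupCochain_coboundary_right f'.2 hg1))

end Cup

section Quasimorphisms

variable {G : Type*} [Group G]

/-- A quasimorphism: a real function whose defect is bounded. -/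
def IsQuasimorphism (φ : G → ℝ) : Prop :=
  ∃ D : ℝ, ∀ g h : G, |φ g + φ h - φ (g * h)| ≤ D

/-- A function on `G`, seen as an inhomogeneous `1`-cochain. -/
def toCochain (φ : G → ℝ) : Cochain G 1 := fun x => φ (x 0)

theorem coboundary_toCochain (φ : G → ℝ) (x : Fin 2 → G) :
    coboundary G 1 (toCochain φ) x = φ (x 0) + φ (x 1) - φ (x 0 * x 1) := by
  simp [coboundary, toCochain, Fin.contractNth]
  ring

theorem coboundary_mem_cocycles {φ : G → ℝ} (hφ : IsQuasimorphism φ) :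
    coboundary G 1 (toCochain φ) ∈ boundedCocycles G 2 := by
  obtain ⟨D, hD⟩ := hφ
  refine ⟨⟨D, fun x => ?_⟩, LinearMap.mem_ker.2 (funext fun x => ?_)⟩
  · rw [coboundary_toCochain]
    exact hD _ _
  · have e : coboundary G 2 (coboundary G 1 (toCochain φ)) x =
        coboundary G 1 (toCochain φ) (fun i => x i.succ)
        + ∑ j : Fin 2, (-1 : ℝ) ^ ((j : ℕ) + 1)
          * coboundary G 1 (toCochain φ) (Fin.contractNth j.castSucc (· * ·) x)
        + (-1 : ℝ) ^ (2 + 1) * coboundary G 1 (toCochain φ) (fun i => x i.castSucc) := rfl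
    rw [e]
    simp [coboundary_toCochain, Fin.sum_univ_two, Fin.contractNth, mul_assoc]
    ring

/-- The class `[δ¹φ] ∈ H_b^2(G, ℝ)` of a quasimorphism `φ`. -/
def quasimorphismClass (φ : G → ℝ) (hφ : IsQuasimorphism φ) : Hb G 2 :=
  Submodule.Quotient.mk ⟨coboundary G 1 (toCochain φ), coboundary_mem_cocycles hφ⟩

end Quasimorphisms

end BoundedCohomology

namespace DeltaDecomposition

variable {ι F : Type*} [Group F]

open Classical in
/-- The reduced word, in the letters `b i` and `(b i)⁻¹`, of an element of a free group with
free basis `b`. -/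
noncomputable def reducedWord (b : FreeGroupBasis ι F) (g : F) : List (ι × Bool) :=
  (b.repr g).toWord

/-- A set of pieces: a symmetric subset that does not contain the identity. -/
structure IsPieceSet (P : Set F) : Prop where
  inv_mem : ∀ p ∈ P, p⁻¹ ∈ P
  one_notMem : (1 : F) ∉ P

/-- Elements `c₁, c₂, c₃` (the `c`-part) and `r₁, r₂, r₃` (the `r`-part) that write the sequences
`Δ(g)`, `Δ(h)`, `Δ(gh)` as a `(g, h)`-triangle. -/
structure IsTriangle (Δ : F → List F) (g h : F) (c r : Fin 3 → F) : Prop where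
  left : Δ g = Δ (c 0)⁻¹ ++ Δ (r 0) ++ Δ (c 1)
  right : Δ h = Δ (c 1)⁻¹ ++ Δ (r 1) ++ Δ (c 2)
  prod : Δ (g * h) = Δ (c 0)⁻¹ ++ Δ (r 2)⁻¹ ++ Δ (c 2)

/-- `Δ` is a `Δ`-decomposition of the free group `F` (with free basis `b`) into the pieces `P`. -/
structure IsDeltaDecomposition (b : FreeGroupBasis ι F) (P : Set F) (Δ : F → List F) : Prop where
  /-- `Δ` takes values in the finite sequences of pieces. -/
  mem_pieces : ∀ g, ∀ p ∈ Δ g, p ∈ P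
  /-- `g = g₁ ⋯ g_K` as a reduced word: no cancellation between the reduced words of the `g_j`. -/
  reduced : ∀ g, reducedWord b g = ((Δ g).map (reducedWord b)).flatten
  /-- `Δ(g⁻¹) = (g_K⁻¹, …, g₁⁻¹)`. -/
  inv : ∀ g, Δ g⁻¹ = ((Δ g).map (·⁻¹)).reverse
  /-- `Δ(g_i ⋯ g_j) = (g_i, …, g_j)` for `i ≤ j` (contiguous nonempty subsequences of `Δ g`). -/
  infix_prod : ∀ g, ∀ l : List F, l ≠ [] → l <:+: Δ g → Δ l.prod = l
  /-- There is a uniform bound `R` on the `r`-part of all triangles whose `c`-part has maximal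
  length. (Two triangles on the same `g` and `h` can always be combined: `Δ(c₁⁻¹)` and `Δ(c₂)`
  do not overlap in `Δ(g)`, and so on, because the words are reduced. Hence a triangle in which
  the three lengths are maximal at the same time exists, and the lengths of its `r`-part are
  determined by `g` and `h`.) -/
  triangle : ∃ R : ℕ, 0 < R ∧ ∀ g h : F, ∃ c r : Fin 3 → F, IsTriangle Δ g h c r ∧
    (∀ c' r' : Fin 3 → F, IsTriangle Δ g h c' r' → ∀ i, (Δ (c' i)).length ≤ (Δ (c i)).length) ∧
    ∀ i, (Δ (r i)).length ≤ R

/-- `φ` is a `Δ`-decomposable quasimorphism on the free group `F` with free basis `b`: there are a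
set of pieces `P`, a `Δ`-decomposition `Δ` into the pieces `P` and a bounded alternating function
`lam` on `P` with `φ(g) = ∑ lam(g_j)` where `Δ(g) = (g₁, …, g_K)`. (The values of `lam` outside
`P` play no role.) -/
def IsDeltaDecomposable (b : FreeGroupBasis ι F) (φ : F → ℝ) : Prop :=
  ∃ (P : Set F) (Δ : F → List F) (lam : F → ℝ),
    IsPieceSet P ∧ IsDeltaDecomposition b P Δ ∧
    (∃ C : ℝ, ∀ p ∈ P, |lam p| ≤ C) ∧ (∀ p ∈ P, lam p⁻¹ = -lam p) ∧
    ∀ g, φ g = ((Δ g).map lam).sum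

/-- A `Δ`-decomposable quasimorphism is a quasimorphism. -/
theorem IsDeltaDecomposable.isQuasimorphism {b : FreeGroupBasis ι F} {φ : F → ℝ}
    (hφ : IsDeltaDecomposable b φ) : BoundedCohomology.IsQuasimorphism φ := by
  obtain ⟨P, Δ, lam, -, hΔ, ⟨C, hC⟩, halt, hsum⟩ := hφ
  obtain ⟨R, -, hR⟩ := hΔ.triangle
  have hinv : ∀ g, φ g⁻¹ = -φ g := by
    intro g
    have aux : ∀ l : List F, (∀ p ∈ l, p ∈ P) →
        ((l.map (·⁻¹)).map lam).sum = -(l.map lam).sum := by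
      intro l
      induction l with
      | nil => simp
      | cons a l ih =>
        intro hl
        have h1 := ih fun p hp => hl p (List.mem_cons_of_mem _ hp)
        have h2 := halt a (hl a List.mem_cons_self)
        simp only [List.map_cons, List.sum_cons] at h1 ⊢
        rw [h1, h2]
        ring
    rw [hsum, hsum, hΔ.inv, List.map_reverse, List.sum_reverse]
    exact aux _ (hΔ.mem_pieces g)
  have hbd : ∀ g, |φ g| ≤ (Δ g).length * |C| := by
    intro g
    have aux : ∀ l : List F, (∀ p ∈ l, p ∈ P) → |(l.map lam).sum| ≤ l.length * |C| := by
      intro l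
      induction l with
      | nil => simp
      | cons a l ih =>
        intro hl
        have h1 := ih fun p hp => hl p (List.mem_cons_of_mem _ hp)
        have h2 := (hC a (hl a List.mem_cons_self)).trans (le_abs_self C)
        simp only [List.map_cons, List.sum_cons, List.length_cons]
        push_cast
        linarith [abs_add_le (lam a) (l.map lam).sum]
    rw [hsum]
    exact aux _ (hΔ.mem_pieces g)
  refine ⟨3 * (R * |C|), fun g h => ?_⟩
  obtain ⟨c, r, ht, -, hr⟩ := hR g h
  have e1 : φ g = φ (c 0)⁻¹ + φ (r 0) + φ (c 1) := by
    rw [hsum g, ht.left]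
    simp [hsum, add_assoc]
  have e2 : φ h = φ (c 1)⁻¹ + φ (r 1) + φ (c 2) := by
    rw [hsum h, ht.right]
    simp [hsum, add_assoc]
  have e3 : φ (g * h) = φ (c 0)⁻¹ + φ (r 2)⁻¹ + φ (c 2) := by
    rw [hsum (g * h), ht.prod]
    simp [hsum, add_assoc]
  have e4 : φ g + φ h - φ (g * h) = φ (r 0) + φ (r 1) + φ (r 2) := by
    rw [e1, e2, e3, hinv (c 1), hinv (r 2)]
    ring
  have hri : ∀ i, |φ (r i)| ≤ R * |C| := fun i =>
    (hbd _).trans (mul_le_mul_of_nonneg_right (by exact_mod_cast hr i) (abs_nonneg C))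
  rw [e4]
  linarith [abs_add_le (φ (r 0) + φ (r 1)) (φ (r 2)), abs_add_le (φ (r 0)) (φ (r 1)),
    hri 0, hri 1, hri 2]

end DeltaDecomposition

/-! For a bounded cocycle ω representing α, the Leibniz rule gives δ¹φ ∪ ω = δ(φ ∪ ω), but φ ∪ ω is
unbounded. It is corrected by δη, where η replaces the first entry of ω by suffixes of Δ(g),
weighted by `lam`. The cocycle identity of ω, summed over these suffixes (`suffixSum`), turns φ ∪ ω
+ δη at (g, h, …) into suffix sums along the sides g, h, gh of a triangle. The c-parts cancel in
pairs (`IsTriangle.suffixSum_eq`), and the three r-parts have at most R pieces each, so φ ∪ ω + δη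
is bounded and has the same coboundary as φ ∪ ω. -/

namespace BoundedCohomology

/-! ### The identity δ ∘ δ = 0. -/

section CoboundarySquared

universe u

open CategoryTheory

theorem coboundary_apply_eq_sum {G : Type*} [Group G] (n : ℕ) (f : Cochain G n)
    (x : Fin (n + 1) → G) :
    coboundary G n f x = f (fun i => x i.succ)
      + ∑ j : Fin (n + 1), (-1 : ℝ) ^ ((j : ℕ) + 1) * f (Fin.contractNth j (· * ·) x) := by
  rw [Fin.sum_univ_castSucc, ← add_assoc]
  have h : Fin.contractNth (Fin.last n) (· * ·) x = fun i => x i.castSucc := by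
    funext i
    exact Fin.contractNth_apply_of_lt _ _ _ _ (by simp)
  rw [h]
  rfl

/-- This lets δ ∘ δ = 0 be inherited from Mathlib's group cohomology; `ULift` places ℝ in the
universe of `G`. -/
theorem d_trivial_eq_coboundary {G : Type u} [Group G] (n : ℕ) (f : Cochain G n) :
    (inhomogeneousCochains.d
      (Rep.trivial (ULift.{u} ℝ) G (ULift.{u} ℝ)) n).hom (fun x => ULift.up (f x))
      = fun x => ULift.up (coboundary G n f x) := by
  funext x
  rw [coboundary_apply_eq_sum]
  apply ULift.down_injective
  rw [inhomogeneousCochains.d_hom_apply]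
  simp only [smul_eq_mul, ULift.add_down]
  refine congrArg (f (fun i => x i.succ) + ·) ?_
  refine (map_sum (ULift.ringEquiv : ULift.{u} ℝ ≃+* ℝ) _ _).trans ?_
  exact Finset.sum_congr rfl fun j _ => rfl

theorem coboundary_coboundary {G : Type u} [Group G] (n : ℕ) (f : Cochain G n) :
    coboundary G (n + 1) (coboundary G n f) = 0 := by
  have h := congrArg (fun T => T.hom (fun x => ULift.up.{u} (f x)))
    (groupCohomology.inhomogeneousCochains.d_comp_d (n := n)
      (A := Rep.trivial (ULift.{u} ℝ) G (ULift.{u} ℝ)))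
  simp only [ModuleCat.hom_comp, LinearMap.comp_apply] at h
  rw [d_trivial_eq_coboundary, d_trivial_eq_coboundary] at h
  funext x
  exact congrArg ULift.down (congrFun h x)

end CoboundarySquared

/-! ### The coboundary and the first entry of a tuple. -/

section Leibniz

variable {G : Type*} [Group G]

theorem coboundary_cast {N M : ℕ} (h : M = N) (f : Cochain G N) (x : Fin (M + 1) → G) :
    coboundary G M (fun y => f fun i => y (i.cast h.symm)) x
      = coboundary G N f (fun i => x (i.cast (by rw [h]))) := by
  subst h
  rfl

/-- The coboundary of `(x₀, x₁, …) ↦ φ(x₀) * ω(x₁, …)` for a cocycle `ω`. -/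
theorem coboundary_mul_tail (φ : G → ℝ) {m : ℕ} {ω : Cochain G m} (hω : coboundary G m ω = 0)
    (x : Fin (m + 2) → G) :
    coboundary G (m + 1) (fun y => φ (y 0) * ω (Fin.tail y)) x
      = coboundary G 1 (toCochain φ) (fun i => x ⟨i, by omega⟩)
        * ω (fun i => x ⟨i + 2, by omega⟩) := by
  have e : (fun y : Fin (m + 1) → G => φ (y 0) * ω (Fin.tail y))
      = fun y => cupCochain (toCochain φ) ω fun i => y (i.cast (Nat.add_comm 1 m)) := by
    funext y
    unfold cupCochain toCochain
    congr 2
    funext i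
    exact congrArg y (Fin.ext (Nat.add_comm _ _))
  rw [e, coboundary_cast (Nat.add_comm m 1), coboundary_cupCochain, hω]
  simp only [Pi.zero_apply, mul_zero, add_zero]
  congr 2
  funext i
  exact congrArg x (Fin.ext (Nat.add_comm _ _))

/-- The cocycle condition for `ω`, split according to the first entry of the tuple. -/
theorem coboundary_cons (m : ℕ) (ω : Cochain G (m + 1)) (z : G) (y : Fin (m + 1) → G) :
    coboundary G (m + 1) ω (Fin.cons z y) = ω y - ω (Fin.cons (z * y 0) (Fin.tail y))
      - ∑ j : Fin (m + 1), (-1 : ℝ) ^ ((j : ℕ) + 1)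
          * ω (Fin.cons z (Fin.contractNth j (· * ·) y)) := by
  have h0 : Fin.contractNth 0 (· * ·) (Fin.cons z y : Fin (m + 2) → G)
      = Fin.cons (z * y 0) (Fin.tail y) := by
    funext i
    refine Fin.cases ?_ (fun i => ?_) i
    · rw [Fin.contractNth_apply_of_eq _ _ _ _ rfl]
      rfl
    · rw [Fin.contractNth_apply_of_gt _ _ _ _ (by simp)]
      rfl
  have hs : ∀ j : Fin (m + 1), Fin.contractNth j.succ (· * ·) (Fin.cons z y : Fin (m + 2) → G)
      = Fin.cons z (Fin.contractNth j (· * ·) y) := by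
    intro j
    funext i
    refine Fin.cases ?_ (fun i => ?_) i
    · rw [Fin.contractNth_apply_of_lt _ _ _ _ (by simp)]
      rfl
    · simp [Fin.contractNth]
  rw [coboundary_apply_eq_sum, Fin.sum_univ_succ, h0]
  -- Prepending `z` shifts each face index by one, hence the minus sign before the sum.
  simp only [hs, Fin.val_succ, pow_succ _ (_ + 1), mul_neg_one, neg_mul, Finset.sum_neg_distrib]
  simp
  ring

end Leibniz

end BoundedCohomology

namespace DeltaDecomposition

open BoundedCohomology

variable {F : Type*} [Group F]

/-- The sum of `lam p` times the average of `ψ` at the two suffix products that start at, and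
just after, the entry `p`, over all entries `p` of the list. -/
noncomputable def suffixSum (lam : F → ℝ) : List F → (F → ℝ) →ₗ[ℝ] ℝ
  | [] => 0
  | p :: l => (lam p / 2) • ((LinearMap.proj (p * l.prod) : (F → ℝ) →ₗ[ℝ] ℝ) + LinearMap.proj l.prod)
      + suffixSum lam l

/-! ### Weighted sums over the suffixes of a list of pieces. -/

section SuffixSum

variable (lam : F → ℝ)

@[simp]
theorem suffixSum_nil (ψ : F → ℝ) : suffixSum lam [] ψ = 0 := rfl

theorem suffixSum_cons (p : F) (l : List F) (ψ : F → ℝ) :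
    suffixSum lam (p :: l) ψ = lam p / 2 * (ψ (p * l.prod) + ψ l.prod) + suffixSum lam l ψ := rfl

/-- For `l = Δ g` the factor of `a` is φ(g); this is how φ ∪ ω emerges from the cocycle identity. -/
theorem suffixSum_const (l : List F) (a : ℝ) :
    suffixSum lam l (fun _ => a) = (l.map lam).sum * a := by
  induction l with
  | nil => simp
  | cons p l ih =>
    rw [suffixSum_cons, ih, List.map_cons, List.sum_cons]
    ring

theorem suffixSum_append (l l' : List F) (ψ : F → ℝ) :
    suffixSum lam (l ++ l') ψ
      = suffixSum lam l (fun z => ψ (z * l'.prod)) + suffixSum lam l' ψ := by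
  induction l with
  | nil => simp
  | cons p l ih =>
    rw [List.cons_append, suffixSum_cons, suffixSum_cons, ih, List.prod_append, mul_assoc,
      add_assoc]

variable {lam}

/-- Up to right translation by `l.prod⁻¹`, the suffixes before and after a piece trade places when
the list is inverted. The average does not see the swap, and `lam` changes sign. A single suffix in
place of the average would break this symmetry. -/
theorem suffixSum_reverse_inv {P : Set F} (hlam : ∀ p ∈ P, lam p⁻¹ = -lam p) (l : List F)
    (hl : ∀ p ∈ l, p ∈ P) (ψ : F → ℝ) :
    suffixSum lam (l.map (·⁻¹)).reverse ψ = -suffixSum lam l (fun z => ψ (z * l.prod⁻¹)) := by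
  induction l generalizing ψ with
  | nil => simp
  | cons p l ih =>
    rw [List.map_cons, List.reverse_cons, suffixSum_append,
      ih (fun q hq => hl q (List.mem_cons_of_mem _ hq)), suffixSum_cons, suffixSum_cons,
      hlam p (hl p List.mem_cons_self)]
    simp only [List.prod_cons, List.prod_nil, mul_one, mul_inv_rev, mul_assoc, suffixSum_nil,
      mul_inv_cancel_left, mul_inv_cancel]
    ring

theorem abs_suffixSum_le {P : Set F} {C D : ℝ} (hC : ∀ p ∈ P, |lam p| ≤ C) {ψ : F → ℝ}
    (hD : ∀ z, |ψ z| ≤ D) (l : List F) (hl : ∀ p ∈ l, p ∈ P) :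
    |suffixSum lam l ψ| ≤ l.length * (C * D) := by
  induction l with
  | nil => simp
  | cons p l ih =>
    have h1 := ih fun q hq => hl q (List.mem_cons_of_mem _ hq)
    have h2 := hC p (hl p List.mem_cons_self)
    have h3 : |ψ (p * l.prod) + ψ l.prod| ≤ 2 * D :=
      (abs_add_le _ _).trans (by linarith [hD (p * l.prod), hD l.prod])
    have h4 := mul_le_mul h2 h3 (abs_nonneg _) ((abs_nonneg _).trans h2)
    have h5 : |lam p / 2 * (ψ (p * l.prod) + ψ l.prod)| ≤ C * D := by
      rw [abs_mul, abs_div, abs_two]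
      linarith
    rw [suffixSum_cons, List.length_cons]
    push_cast
    linarith [abs_add_le (lam p / 2 * (ψ (p * l.prod) + ψ l.prod)) (suffixSum lam l ψ)]

end SuffixSum

/-! ### Cancellation along a triangle. -/

theorem IsDeltaDecomposition.prod_eq {ι : Type*} {b : FreeGroupBasis ι F} {P : Set F}
    {Δ : F → List F} (hΔ : IsDeltaDecomposition b P Δ) (g : F) : (Δ g).prod = g := by
  classical
  have aux : ∀ l : List F, FreeGroup.mk (l.map (reducedWord b)).flatten = b.repr l.prod := by
    intro l
    induction l with
    | nil => simp [FreeGroup.one_eq_mk]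
    | cons p l ih =>
      rw [List.map_cons, List.flatten_cons, ← FreeGroup.mul_mk, ih, List.prod_cons, map_mul,
        reducedWord, FreeGroup.mk_toWord]
  apply b.repr.injective
  rw [← aux, ← hΔ.reduced, reducedWord, FreeGroup.mk_toWord]

/-- The contributions of the common parts of a triangle cancel. -/
theorem IsTriangle.suffixSum_eq {ι : Type*} {b : FreeGroupBasis ι F} {P : Set F}
    {Δ : F → List F} (hΔ : IsDeltaDecomposition b P Δ) {lam : F → ℝ}
    (hlam : ∀ p ∈ P, lam p⁻¹ = -lam p) {g h : F} {c r : Fin 3 → F} (ht : IsTriangle Δ g h c r)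
    (ψ : F → ℝ) :
    suffixSum lam (Δ g) (fun z => ψ (z * h)) + suffixSum lam (Δ h) ψ
        - suffixSum lam (Δ (g * h)) ψ
      = suffixSum lam (Δ (r 0)) (fun z => ψ (z * (c 1 * h)))
        + suffixSum lam (Δ (r 1)) (fun z => ψ (z * c 2))
        - suffixSum lam (Δ (r 2)⁻¹) (fun z => ψ (z * c 2)) := by
  have hg : g = (c 0)⁻¹ * (r 0 * c 1) := by
    have := congrArg List.prod ht.left
    simpa [hΔ.prod_eq, mul_assoc] using this
  have hh : h = (c 1)⁻¹ * (r 1 * c 2) := by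
    have := congrArg List.prod ht.right
    simpa [hΔ.prod_eq, mul_assoc] using this
  have hgh : g * h = (c 0)⁻¹ * ((r 2)⁻¹ * c 2) := by
    have := congrArg List.prod ht.prod
    simpa [hΔ.prod_eq, mul_assoc] using this
  -- The shared initial part `Δ (c 0)⁻¹` is followed by the same element on the sides g and gh, so
  -- its two contributions agree.
  have e0 : (r 2)⁻¹ * c 2 = r 0 * (c 1 * h) := by
    have : (c 0)⁻¹ * ((r 2)⁻¹ * c 2) = (c 0)⁻¹ * (r 0 * (c 1 * h)) := by
      rw [← hgh]
      nth_rewrite 1 [hg]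
      simp only [mul_assoc]
    exact mul_left_cancel this
  have e1 : r 1 * c 2 = c 1 * h := by rw [hh, mul_inv_cancel_left]
  -- The end of g and the beginning of h run through the same pieces in opposite directions.
  have hc1 : suffixSum lam (Δ (c 1)⁻¹) (fun z => ψ (z * (c 1 * h)))
      = -suffixSum lam (Δ (c 1)) (fun z => ψ (z * h)) := by
    rw [hΔ.inv, suffixSum_reverse_inv hlam _ (hΔ.mem_pieces _), hΔ.prod_eq]
    simp only [mul_assoc, inv_mul_cancel_left]
  rw [ht.left, ht.right, ht.prod]
  simp only [List.append_assoc, suffixSum_append, List.prod_append, hΔ.prod_eq, mul_assoc, e0, e1,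
    hc1]
  ring

end DeltaDecomposition

/-! ### The bounded primitive and the conclusion. -/

namespace DeltaDecomposition

open BoundedCohomology

variable {F : Type*} [Group F]

/-- The cochain `(x₀, …, xₘ₊₁) ↦ φ(x₀) * ω(x₁, …, xₘ₊₁)` differs from a bounded cochain by a
coboundary, namely that of `(x₀, …, xₘ) ↦ ∑ lam(pⱼ) * ω(zⱼ, x₁, …, xₘ)`, where `Δ(x₀) = (p₁, …)`
and `ω(zⱼ, …)` stands for the average over the two suffixes of `Δ(x₀)` adjacent to `pⱼ`. -/
theorem IsDeltaDecomposable.exists_bounded_primitive {ι : Type*} {b : FreeGroupBasis ι F}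
    {φ : F → ℝ} (hφ : IsDeltaDecomposable b φ) {m : ℕ} {ω : Cochain F (m + 1)}
    (hω : coboundary F (m + 1) ω = 0) {D : ℝ} (hD : ∀ x, |ω x| ≤ D) :
    ∃ β ∈ boundedCochains F (m + 2), coboundary F (m + 2) β
      = coboundary F (m + 2) (fun y => φ (y 0) * ω (Fin.tail y)) := by
  obtain ⟨P, Δ, lam, -, hΔ, ⟨C, hC⟩, halt, hsum⟩ := hφ
  obtain ⟨R, -, hR⟩ := hΔ.triangle
  let η : Cochain F (m + 1) := fun x =>
    suffixSum lam (Δ (x 0)) fun z => ω (Fin.cons z (Fin.tail x))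
  -- Three r-parts of at most R pieces, each piece contributing at most |C| * D; `|C|` because `C`
  -- may be negative when `P` is empty.
  refine ⟨(fun y => φ (y 0) * ω (Fin.tail y)) + coboundary F (m + 1) η, ⟨3 * (R * (|C| * D)), ?_⟩,
    by rw [map_add, coboundary_coboundary, add_zero]⟩
  intro x
  obtain ⟨g, y, rfl⟩ : ∃ (g : F) (y : Fin (m + 1) → F), x = Fin.cons g y :=
    ⟨x 0, Fin.tail x, (Fin.cons_self_tail x).symm⟩
  -- The cocycle identity is read as an equation between functions of the first entry `z`, to which
  -- the linear map `suffixSum lam (Δ g)` applies.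
  have hcocycle : (fun _ => ω y) - (fun z => ω (Fin.cons (z * y 0) (Fin.tail y)))
      - ∑ j : Fin (m + 1), (-1 : ℝ) ^ ((j : ℕ) + 1)
        • (fun z => ω (Fin.cons z (Fin.contractNth j (· * ·) y))) = 0 := by
    funext z
    have h := coboundary_cons m ω z y
    rw [hω] at h
    simpa [Finset.sum_apply] using h.symm
  have h1 := congrArg (suffixSum lam (Δ g)) hcocycle
  simp only [map_sub, map_sum, map_smul, map_zero, suffixSum_const, ← hsum, smul_eq_mul] at h1
  -- The faces that leave `g` untouched cancel against those in `h1`.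
  have h2 : φ g * ω y + coboundary F (m + 1) η (Fin.cons g y)
      = suffixSum lam (Δ g) (fun z => ω (Fin.cons (z * y 0) (Fin.tail y)))
        + suffixSum lam (Δ (y 0)) (fun z => ω (Fin.cons z (Fin.tail y)))
        - suffixSum lam (Δ (g * y 0)) (fun z => ω (Fin.cons z (Fin.tail y))) := by
    rw [coboundary_cons]
    simp only [η, Fin.cons_zero, Fin.tail_cons]
    linarith
  obtain ⟨c, r, ht, -, hr⟩ := hR g (y 0)
  have hbound : ∀ s : F, (Δ s).length ≤ R → ∀ t : F,
      |suffixSum lam (Δ s) (fun z => ω (Fin.cons (z * t) (Fin.tail y)))| ≤ R * (|C| * D) := by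
    intro s hs t
    refine (abs_suffixSum_le (fun p hp => (hC p hp).trans (le_abs_self C)) (fun z => hD _) _
      (hΔ.mem_pieces s)).trans ?_
    exact mul_le_mul_of_nonneg_right (by exact_mod_cast hs)
      (mul_nonneg (abs_nonneg C) ((abs_nonneg _).trans (hD y)))
  rw [Pi.add_apply, Fin.cons_zero, Fin.tail_cons, h2,
    ht.suffixSum_eq hΔ halt fun z => ω (Fin.cons z (Fin.tail y))]
  have b0 := hbound _ (hr 0) (c 1 * y 0)
  have b1 := hbound _ (hr 1) (c 2)
  have b2 := hbound (r 2)⁻¹ (by rw [hΔ.inv]; simpa using hr 2) (c 2)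
  rw [abs_le] at b0 b1 b2 ⊢
  constructor <;> linarith

end DeltaDecomposition

theorem theoremA {ι F : Type*} [Group F] (b : FreeGroupBasis ι F)
    (hF : ∃ x y : F, x * y ≠ y * x) (k : ℕ) (hk : 0 < k)
    (φ : F → ℝ) (hφ : DeltaDecomposition.IsDeltaDecomposable b φ)
    (α : BoundedCohomology.Hb F k) :
    BoundedCohomology.cup
      (BoundedCohomology.quasimorphismClass φ hφ.isQuasimorphism) α = 0 := by
  -- Positive degree gives ω a first entry in which suffixes can be inserted.
  obtain ⟨m, rfl⟩ := Nat.exists_eq_succ_of_ne_zero hk.ne'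
  obtain ⟨⟨ω, ⟨D, hD⟩, hω⟩, rfl⟩ := Submodule.Quotient.mk_surjective _ α
  replace hω : BoundedCohomology.coboundary F (m + 1) ω = 0 := hω
  refine (Submodule.Quotient.mk_eq_zero _).2 ?_
  change BoundedCohomology.cupCochain (BoundedCohomology.coboundary F 1
    (BoundedCohomology.toCochain φ)) ω ∈ BoundedCohomology.boundedCoboundaries F (2 + (m + 1))
  obtain ⟨β, hβ, hβφ⟩ := hφ.exists_bounded_primitive hω hD
  -- The degrees `m + 3` and `2 + (m + 1)` agree only propositionally, hence the cast.
  have key : ∀ (N : ℕ) (h : m + 3 = N) (f : BoundedCohomology.Cochain F N),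
      (∀ x : Fin N → F, f x
        = BoundedCohomology.coboundary F (m + 2) β (fun i => x (i.cast h))) →
      f ∈ BoundedCohomology.boundedCoboundaries F N := by
    rintro N rfl f hf
    exact ⟨β, hβ, (funext hf).symm⟩
  refine key _ (by omega) _ fun x => ?_
  rw [hβφ, BoundedCohomology.coboundary_mul_tail φ hω]
  unfold BoundedCohomology.cupCochain
  congr 2
  funext i
  exact congrArg x (Fin.ext (Nat.add_comm _ _))
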